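/- Setting. There are agents $\mathcal K=\{1,\dots,K\}$ and goods $\mathcal N=\{1,\dots,N\}$ with unknown qualities $\mu\in\mathbb R^N$. Agent $j$ has a set $\mathcal A_j\subseteq 2^{\mathcal N}$ of accessible bundles and a reward function $r^j:\mathbb R^N\times\mathcal A_j\to\mathbb R$. Let $\mathcal M^*$ be any set of assignments $\phi$ with $\phi(j)\in\mathcal A_j$ for all $j$, and for every $\phi$ and $L\subseteq\mathcal K$ let $\mathcal M^*|_{\phi,L}$ be any set of maps $\phi'$ on $L$ with $\phi'(j)\in\mathcal A_j$. A deviation from $\phi$ is a pair $(L,\phi')$ with $\emptyset\neq L\subseteq\mathcal K$, $|L|\le\kappa$, $\phi'\in\mathcal M^*|_{\phi,L}$. Put $g^L(x;y;\phi\to\phi')=\max_{j\in L}\{r^j(x;\phi(j))-r^j(y;\phi'(j))\}$ and $g^L(\mu;\phi\to\phi')=g^L(\mu;\mu;\phi\to\phi')$, and let $\mathbb F(\mu,\eta)$ (the $\eta$-stable assignments) be the set of $\phi\in\mathcal M^*$ with $g^L(\mu;\phi\to\phi')\ge\eta$ for all deviations $(L,\phi')$ from $\phi$. Algorithm (Feasibility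 ULCB). Sampling good $i$ at period $t$ gives $X_i(t)=\mu_i+\epsilon_i(t)$, where the noise vectors $(\epsilon_i(t))_{i}$ are independent over $t$ and each $\epsilon_i(t)$ is centred and $\sigma^2$-subgaussian, $\sigma>0$. In the periods $1,\dots,N$ each good is sampled once, one per period. At a period $t>N$, with $T_i(t-1)$ the number of earlier samples of good $i$ and $\hat\mu_i$ their average, put $\bar\nu_i(t)=\hat\mu_i+\sqrt{2\sigma^2\log(t^\alpha)/T_i(t-1)}$ and $\underline\nu_i(t)=\hat\mu_i-\sqrt{2\sigma^2\log(t^\alpha)/T_i(t-1)}$. The decision is $\delta_t=1$ if some $\phi\in\mathcal M^*$ satisfies $g^L(\underline\nu(t);\bar\nu(t);\phi\to\phi')\ge\varepsilon$ for all deviations $(L,\phi')$ from $\phi$, and $\delta_t=0$ otherwise. An oracle, a function of $(\underline\nu(t),\bar\nu(t))$, returns $\phi_t\in\mathcal M^*$, a coalition $L_t$ with $|L_t|\le\kappa$, and $\phi'_t$ as follows. If $\delta_t=1$, then $\phi_t$ satisfies the inequalities in the definition of $\delta_t$. If $\delta_t=0$, then $\phi_t$ satisfies $g^L(\bar\nu(t);\underline\nu(t);\phi_t\to\phi')\ge\eta$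 for all deviations $(L,\phi')$ whenever some assignment in $\mathcal M^*$ has this property, and $(L_t,\phi'_t)$ is a deviation from $\phi_t$ with $g^{L_t}(\underline\nu(t);\bar\nu(t);\phi_t\to\phi'_t)<\varepsilon$. Ties and all other choices are arbitrary. All goods of the bundles $\phi_t(j),\phi'_t(j)$, $j\in L_t$, are then sampled. In the $N$ initial periods $\delta_t:=0$. Theorem. Let $\alpha>2$, $T>N$, $\eta>0$, $c>0$, and assume: (a) for all $j$, $S\in\mathcal A_j$ and $x,y\in\mathbb R^N$, $|r^j(x;S)-r^j(y;S)|\le c\sum_{i\in S}|x_i-y_i|$, and $r^j(x;S)\le r^j(y;S)$ if $x_i\le y_i$ for all $i\in S$; (b) for some $\Delta>0$, $\eta-g^L(\mu;\phi\to\phi')\ge\Delta$ for every $\phi\in\mathcal M^*\setminus\mathbb F(\mu,\eta)$ and every deviation $(L,\phi')$ from $\phi$ with $g^L(\mu;\phi\to\phi')<\eta$; and $\eta-\Delta<\varepsilon<\eta$. If $\mathbb F(\mu,\eta)\neq\emptyset$ (the alternative hypothesis), the expected number of type-II errors of Feasibility ULCB satisfies $$R_T^{H_a}=\mathbb E\Big[\sum_{t=1}^T\mathbf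 1\{\delta_t=0\}\Big]\le C_1^*\big(\Delta^{-2}+2(\eta-\varepsilon)^{-2}\big)N^3\log T+N\,C_2^*,$$ where $C_1^*$ depends only on $\kappa,\sigma^2,\alpha$ and the Lipschitz constant $c$ of the rewards, and $C_2^*$ depends only on $\alpha$. -/

import Mathlib

open MeasureTheory ProbabilityTheory
open scoped NNReal

universe u

namespace FeasibilityULCB

/-- An assignment gives every one of the `K` agents a bundle of the `N` goods. -/
abbrev Assignment (K N : ℕ) : Type := Fin K → Finset (Fin N)

/-- The data of the stable assignment model with `K` agents and `N` goods.

* `access j` is the set of bundles accessible to agent `j`;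
* `reward j x S` is the reward of agent `j` for the bundle `S` when the qualities are `x`
  (only the values at `S ∈ access j` are ever used);
* `feasible` is the (arbitrary) set of feasible assignments;
* `deviations φ L` is the (arbitrary) set of deviating assignments of the coalition `L` from `φ`.
  A deviating assignment is a map defined on `L`; it is represented by a total map, and only its
  values at the members of `L` are ever used;
* `κ` is the maximal size of a deviating coalition. -/
structure StableModel (K N : ℕ) where
  access : Fin K → Set (Finset (Fin N))
  reward : Fin K → (Fin N → ℝ) → Finset (Fin N) → ℝ
  feasible : Set (Assignment K N)
  feasible_access : ∀ φ ∈ feasible, ∀ j, φ j ∈ access j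
  deviations : Assignment K N → Finset (Fin K) → Set (Assignment K N)
  deviations_access : ∀ φ L, ∀ φ' ∈ deviations φ L, ∀ j ∈ L, φ' j ∈ access j
  κ : ℕ

variable {K N : ℕ}

namespace StableModel

/-- The benefit of a coalition `L` for staying with `φ` instead of deviating to `φ'`, where the
current bundles are evaluated at `x` and the deviating bundles at `y`:
the maximum over `j ∈ L` of `r^j(x, φ(j)) - r^j(y, φ'(j))` (used for nonempty `L` only). -/
noncomputable def benefit (M : StableModel K N) (x y : Fin N → ℝ)
    (φ : Assignment K N) (L : Finset (Fin K)) (φ' : Assignment K N) : ℝ :=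
  ⨆ j : L, (M.reward j x (φ j) - M.reward j y (φ' j))

/-- `(L, φ')` is an admissible deviation from `φ`: a nonempty coalition of at most `κ` agents
with one of its deviating assignments. -/
def IsDeviation (M : StableModel K N) (φ : Assignment K N)
    (L : Finset (Fin K)) (φ' : Assignment K N) : Prop :=
  L.Nonempty ∧ L.card ≤ M.κ ∧ φ' ∈ M.deviations φ L

/-- Every admissible deviation from `φ` has benefit at least `θ` when the current bundles are
evaluated at `x` and the deviating bundles at `y`. -/
def Resists (M : StableModel K N) (x y : Fin N → ℝ) (θ : ℝ) (φ : Assignment K N) : Prop :=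
  ∀ L φ', M.IsDeviation φ L φ' → θ ≤ M.benefit x y φ L φ'

/-- The set of `θ`-stable assignments at the qualities `μ`. -/
def stableSet (M : StableModel K N) (μ : Fin N → ℝ) (θ : ℝ) : Set (Assignment K N) :=
  {φ | φ ∈ M.feasible ∧ M.Resists μ μ θ φ}

/-- The rewards are Lipschitz with constant `c` and monotone in the qualities of the goods of the
bundle. -/
def LipschitzMonotone (M : StableModel K N) (c : ℝ) : Prop :=
  ∀ j, ∀ S ∈ M.access j, ∀ x y : Fin N → ℝ,
    |M.reward j x S - M.reward j y S| ≤ c * ∑ i ∈ S, |x i - y i| ∧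
    ((∀ i ∈ S, x i ≤ y i) → M.reward j x S ≤ M.reward j y S)

/-- The separation of the `η`-stable set from its complement by the gap `Δ`: the infimum of
`η - g^L(μ, φ → φ')` over the feasible `φ` that are not `η`-stable and the admissible deviations
with `g^L(μ, φ → φ') < η` is at least `Δ`. -/
def Separated (M : StableModel K N) (μ : Fin N → ℝ) (η Δ : ℝ) : Prop :=
  ∀ φ ∈ M.feasible \ M.stableSet μ η, ∀ L φ', M.IsDeviation φ L φ' →
    M.benefit μ μ φ L φ' < η → Δ ≤ η - M.benefit μ μ φ L φ'

/-- The test rejects the null hypothesis: with the lower estimates `lo` and the upper estimates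
`up` of the qualities, the lower estimate of every deviation benefit is at least `ε` for some
feasible assignment. -/
def Rejects (M : StableModel K N) (ε : ℝ) (lo up : Fin N → ℝ) : Prop :=
  ∃ φ ∈ M.feasible, M.Resists lo up ε φ

end StableModel

/-- The output of the oracle besides the decision: an assignment, a coalition and a deviating
assignment of the coalition. -/
structure OracleOutput (K N : ℕ) where
  φ : Assignment K N
  L : Finset (Fin K)
  φ' : Assignment K N

/-- `O lo up` solves the static stability problem for the lower and upper quality estimates.
If the test rejects, it returns a feasible assignment certified to be `ε`-stable. Otherwise it
returns a feasible assignment that could be `η`-stable, if there is one (else any feasible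
assignment), and an admissible deviation showing that it is not certified to be `ε`-stable.
Ties are broken in an arbitrary way, and so is the choice of the at most `κ` agents that are
asked for feedback when the test rejects. The last condition is measurability (the output type
is finite). -/
structure IsOracle (M : StableModel K N) (η ε : ℝ)
    (O : (Fin N → ℝ) → (Fin N → ℝ) → OracleOutput K N) : Prop where
  feasible : ∀ lo up, (O lo up).φ ∈ M.feasible
  card_le : ∀ lo up, (O lo up).L.card ≤ M.κ
  of_rejects : ∀ lo up, M.Rejects ε lo up → M.Resists lo up ε (O lo up).φ
  optimistic : ∀ lo up, ¬ M.Rejects ε lo up →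
    (∃ φ ∈ M.feasible, M.Resists up lo η φ) → M.Resists up lo η (O lo up).φ
  evidence : ∀ lo up, ¬ M.Rejects ε lo up →
    M.IsDeviation (O lo up).φ (O lo up).L (O lo up).φ' ∧
      M.benefit lo up (O lo up).φ (O lo up).L (O lo up).φ' < ε
  measurable : ∀ o, MeasurableSet {p : (Fin N → ℝ) × (Fin N → ℝ) | O p.1 p.2 = o}

/-- The statistics kept by the learner: for every good the number of signals collected and
their sum. -/
structure Stats (N : ℕ) where
  count : Fin N → ℕ
  total : Fin N → ℝ

namespace Stats

/-- The average of the collected signals of the good `i`. -/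
noncomputable def mean (s : Stats N) (i : Fin N) : ℝ := s.total i / s.count i

/-- The confidence radius of the good `i` at period `t`. -/
noncomputable def radius (s : Stats N) (σ α : ℝ) (t : ℕ) (i : Fin N) : ℝ :=
  √(1 / (s.count i : ℝ) * (2 * σ ^ 2 * Real.log ((t : ℝ) ^ α)))

/-- Upper confidence bounds at period `t`, from the statistics of the earlier periods. -/
noncomputable def ucb (s : Stats N) (σ α : ℝ) (t : ℕ) : Fin N → ℝ :=
  fun i => s.mean i + s.radius σ α t i

/-- Lower confidence bounds at period `t`, from the statistics of the earlier periods. -/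
noncomputable def lcb (s : Stats N) (σ α : ℝ) (t : ℕ) : Fin N → ℝ :=
  fun i => s.mean i - s.radius σ α t i

end Stats

/-- The goods sampled at period `t`, given the statistics `s` of the earlier periods.
In the periods `1, …, N` every good is sampled once, one good per period. Afterwards the goods of
the bundles `φ_t(j)` and `φ'_t(j)` for `j ∈ L_t` are sampled. -/
noncomputable def pulls (O : (Fin N → ℝ) → (Fin N → ℝ) → OracleOutput K N) (σ α : ℝ)
    (t : ℕ) (s : Stats N) : Finset (Fin N) :=
  if t ≤ N then Finset.univ.filter (fun i : Fin N => (i : ℕ) + 1 = t)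
  else
    let o := O (s.lcb σ α t) (s.ucb σ α t)
    o.L.biUnion (fun j => o.φ j ∪ o.φ' j)

/-- The statistics at the end of period `t` when the algorithm runs on the signals `X`, where
`X t i` is the signal that a sample of the good `i` at period `t` gives. -/
noncomputable def run (O : (Fin N → ℝ) → (Fin N → ℝ) → OracleOutput K N) (σ α : ℝ)
    (X : ℕ → Fin N → ℝ) : ℕ → Stats N
  | 0 => ⟨fun _ => 0, fun _ => 0⟩
  | t + 1 =>
    let s := run O σ α X t
    let P := pulls O σ α (t + 1) s
    ⟨fun i => s.count i + (if i ∈ P then 1 else 0),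
     fun i => s.total i + (if i ∈ P then X (t + 1) i else 0)⟩

open Classical in
/-- The decision at period `t ≥ 1`: `1` if the null hypothesis is rejected, `0` if not.
No test is made in the `N` initial periods, where the null hypothesis is thus not rejected. -/
noncomputable def decision (M : StableModel K N)
    (O : (Fin N → ℝ) → (Fin N → ℝ) → OracleOutput K N) (σ α ε : ℝ)
    (X : ℕ → Fin N → ℝ) (t : ℕ) : ℕ :=
  let s := run O σ α X (t - 1)
  if N < t ∧ M.Rejects ε (s.lcb σ α t) (s.ucb σ α t) then 1 else 0

/-- The number of periods among `1, …, T` in which the null hypothesis is not rejected. -/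
noncomputable def acceptCount (M : StableModel K N)
    (O : (Fin N → ℝ) → (Fin N → ℝ) → OracleOutput K N) (σ α ε : ℝ)
    (X : ℕ → Fin N → ℝ) (T : ℕ) : ℝ :=
  ∑ t ∈ Finset.Icc 1 T, if decision M O σ α ε X t = 0 then 1 else 0

end FeasibilityULCB

/-! Suppose the confidence bounds hold at an accepting period. By monotonicity of the rewards, an
`η`-stable assignment still looks `η`-stable when current bundles are valued optimistically and
deviations pessimistically. Hence the oracle's assignment passes this optimistic test too, whereas
its evidence deviation has pessimistic benefit below `ε`. The two values of that one deviation are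
more than `η - ε` apart, so by the Lipschitz property some good involved has confidence radius at
least `(η - ε) / (4cN)` (`exists_wide_good`). That good is sampled in this period and has at most `B
= 32 c² σ² α N² log T / (η - ε)²` earlier samples (`exists_scarce_pulled`). Charging the period to
this good gives at most `B + 1` such periods per good (`sum_pulled_scarce_le`).

It remains to count the periods with a violated confidence bound. Sampling is adaptive, so the tail
bound comes from an exponential supermartingale (`lintegral_exp_noise_le_one`) and a union over
goods and possible sample counts (`measureReal_not_confident_le`). The resulting probabilities `2N
(t+1)^(1-α)` are summable because `α > 2`. -/

namespace FeasibilityULCB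

variable {K N : ℕ}

/-! ### Deviation benefits over a confidence box. -/

namespace StableModel

/-- A resisted threshold persists when the estimates of the current bundles grow and those of the
deviating bundles shrink. -/
lemma Resists.mono {M : StableModel K N} {c : ℝ} (hM : M.LipschitzMonotone c)
    {φ : Assignment K N} (hφ : φ ∈ M.feasible) {x y x' y' : Fin N → ℝ} {θ : ℝ}
    (h : M.Resists x y θ φ) (hx : x ≤ x') (hy : y' ≤ y) : M.Resists x' y' θ φ := by
  intro L φ' hd
  refine (h L φ' hd).trans ?_
  refine ciSup_mono (Set.finite_range _).bddAbove fun j => ?_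
  have h1 := (hM j _ (M.feasible_access φ hφ j) x x').2 fun i _ => hx i
  have h2 := (hM j _ (M.deviations_access φ L φ' hd.2.2 j j.2) y' y).2 fun i _ => hy i
  linarith

/-- If the confidence box certifies the deviation neither as harmless nor as profitable, then one
of the goods involved has a wide confidence interval. -/
lemma exists_wide_good {M : StableModel K N} {c : ℝ} (hc : 0 < c) (hM : M.LipschitzMonotone c)
    {φ : Assignment K N} (hφ : φ ∈ M.feasible) {L : Finset (Fin K)} {φ' : Assignment K N}
    (hd : M.IsDeviation φ L φ') {m w : Fin N → ℝ} (hw : ∀ i, 0 ≤ w i) {ε η : ℝ} (hεη : ε < η)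
    (hη : η ≤ M.benefit (fun i => m i + w i) (fun i => m i - w i) φ L φ')
    (hε : M.benefit (fun i => m i - w i) (fun i => m i + w i) φ L φ' < ε) :
    ∃ i ∈ L.biUnion (fun j => φ j ∪ φ' j), η - ε ≤ 4 * c * N * w i := by
  have hne : Nonempty L := hd.1.to_subtype
  -- Both benefits are compared at one agent: `j` attains the optimistic maximum, and its
  -- pessimistic value is at most the pessimistic maximum, hence below `ε`.
  obtain ⟨j, hj⟩ := exists_eq_ciSup_of_finite (ι := L) (f := fun j : L =>
    M.reward j (fun i => m i + w i) (φ j) - M.reward j (fun i => m i - w i) (φ' j))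
  have hj' := le_ciSup (ι := L) (Set.finite_range fun j : L =>
    M.reward j (fun i => m i - w i) (φ j) - M.reward j (fun i => m i + w i) (φ' j)).bddAbove j
  unfold benefit at hη hε
  rw [← hj] at hη
  have key : ∀ S ∈ M.access j, M.reward j (fun i => m i + w i) S -
      M.reward j (fun i => m i - w i) S ≤ c * ∑ i ∈ S, 2 * w i := by
    intro S hS
    refine (le_abs_self _).trans ((hM j S hS _ _).1.trans_eq ?_)
    congr 1
    refine Finset.sum_congr rfl fun i _ => ?_
    rw [show m i + w i - (m i - w i) = 2 * w i by ring, abs_of_nonneg (by linarith [hw i])]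
  have h1 := key _ (M.feasible_access φ hφ j)
  have h2 := key _ (M.deviations_access φ L φ' hd.2.2 j j.2)
  have h3 : η - ε < c * ∑ i ∈ φ j, 2 * w i + c * ∑ i ∈ φ' j, 2 * w i := by
    linarith
  by_contra! hcon
  -- Without goods both sums in `h3` vanish, which contradicts `ε < η`.
  have hN : 0 < N := by
    rcases Nat.eq_zero_or_pos N with rfl | h
    · simp [Finset.eq_empty_of_isEmpty] at h3
      linarith
    · exact h
  have hN' : (0 : ℝ) < N := by exact_mod_cast hN
  -- Each of the two bundles can account for at most half of the gap: it has at most `N` goods, each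
  -- contributing `2cw`, which explains the factor `4cN`.
  have bound : ∀ S : Finset (Fin N), (∀ i ∈ S, 4 * c * N * w i < η - ε) →
      c * ∑ i ∈ S, 2 * w i ≤ (η - ε) / 2 := by
    intro S hS
    have : ∑ i ∈ S, 2 * w i ≤ ∑ _i ∈ S, (η - ε) / (2 * c * N) := by
      refine Finset.sum_le_sum fun i hi => ?_
      rw [le_div_iff₀ (by positivity)]
      linarith [hS i hi]
    rw [Finset.sum_const, nsmul_eq_mul] at this
    have hcard : (S.card : ℝ) ≤ N := by
      exact_mod_cast (Finset.card_le_univ S).trans_eq (Fintype.card_fin N)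
    have h5 : (S.card : ℝ) * ((η - ε) / (2 * c * N)) ≤ N * ((η - ε) / (2 * c * N)) :=
      mul_le_mul_of_nonneg_right hcard (div_nonneg (by linarith) (by positivity))
    calc c * ∑ i ∈ S, 2 * w i ≤ c * (N * ((η - ε) / (2 * c * N))) := by
          gcongr
          exact this.trans h5
      _ = (η - ε) / 2 := by field_simp
  have h4 := bound (φ j) fun i hi => hcon i (Finset.mem_biUnion.2 ⟨j, j.2, by simp [hi]⟩)
  have h5 := bound (φ' j) fun i hi => hcon i (Finset.mem_biUnion.2 ⟨j, j.2, by simp [hi]⟩)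
  linarith

/-- The Lipschitz bound forces continuity in the qualities. It is available only for accessible
bundles, hence the hypothesis on `S`. -/
lemma LipschitzMonotone.measurable_reward {M : StableModel K N} {c : ℝ}
    (hM : M.LipschitzMonotone c) {j : Fin K} {S : Finset (Fin N)} (hS : S ∈ M.access j) :
    Measurable fun x => M.reward j x S := by
  refine Continuous.measurable (continuous_iff_continuousAt.2 fun y => ?_)
  rw [ContinuousAt, tendsto_iff_norm_sub_tendsto_zero]
  refine squeeze_zero (g := fun x : Fin N → ℝ => c * ∑ i ∈ S, |x i - y i|)
    (fun _ => norm_nonneg _) (fun x => (hM j S hS x y).1) ?_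
  have : Continuous fun x : Fin N → ℝ => c * ∑ i ∈ S, |x i - y i| := by fun_prop
  simpa using this.tendsto y

lemma measurableSet_rejects {M : StableModel K N} {c : ℝ} (hM : M.LipschitzMonotone c) (ε : ℝ) :
    MeasurableSet {p : (Fin N → ℝ) × (Fin N → ℝ) | M.Rejects ε p.1 p.2} := by
  unfold Rejects Resists
  simp only [Set.ofPred_exists, Set.ofPred_and, Set.ofPred_forall]
  refine MeasurableSet.iUnion fun φ => ?_
  by_cases hφ : φ ∈ M.feasible
  swap
  · simp [hφ]
  refine MeasurableSet.inter (by simp [hφ]) ?_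
  refine MeasurableSet.iInter fun L => MeasurableSet.iInter fun φ' => MeasurableSet.iInter fun hd => ?_
  refine measurableSet_le measurable_const (Measurable.iSup fun j : L => ?_)
  exact ((hM.measurable_reward (M.feasible_access φ hφ j)).comp measurable_fst).sub
    ((hM.measurable_reward (M.deviations_access φ L φ' hd.2.2 j j.2)).comp measurable_snd)

end StableModel

/-- Makes events about the oracle's output countable unions of the measurable level sets. -/
instance : Finite (OracleOutput K N) :=
  Finite.of_injective (β := Assignment K N × Finset (Fin K) × Assignment K N)
    (fun o => (o.φ, o.L, o.φ')) fun a b h => by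
      cases a; cases b; simp_all

/-! ### Sample counts along a run. -/

section Run

variable (O : (Fin N → ℝ) → (Fin N → ℝ) → OracleOutput K N) (σ α : ℝ) (X : ℕ → Fin N → ℝ)

lemma run_count_succ (t : ℕ) (i : Fin N) :
    (run O σ α X (t + 1)).count i = (run O σ α X t).count i +
      if i ∈ pulls O σ α (t + 1) (run O σ α X t) then 1 else 0 := rfl

lemma run_total_succ (t : ℕ) (i : Fin N) :
    (run O σ α X (t + 1)).total i = (run O σ α X t).total i +
      if i ∈ pulls O σ α (t + 1) (run O σ α X t) then X (t + 1) i else 0 := rfl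

lemma run_count_le (t : ℕ) (i : Fin N) : (run O σ α X t).count i ≤ t := by
  induction t with
  | zero => simp [run]
  | succ t ih =>
    rw [run_count_succ]
    split_ifs <;> omega

lemma run_count_mono (i : Fin N) : Monotone fun t => (run O σ α X t).count i :=
  monotone_nat_of_le_succ fun t => by
    simp only [run_count_succ]
    omega

lemma run_count_pos {t : ℕ} (ht : N ≤ t) (i : Fin N) : 0 < (run O σ α X t).count i := by
  have h : 0 < (run O σ α X ((i : ℕ) + 1)).count i := by
    rw [run_count_succ, if_pos]
    · omega
    · simp [pulls, Nat.succ_le_of_lt i.2]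
  exact h.trans_le (run_count_mono O σ α X i (by have := i.2; omega))

/-- A good is sampled at most `B + 1` times while its number of samples is at most `B`. -/
lemma sum_pulled_scarce_le {B : ℝ} (hB : 0 ≤ B) (i : Fin N) (T : ℕ) :
    (∑ t ∈ Finset.range T, if i ∈ pulls O σ α (t + 1) (run O σ α X t) ∧
      ((run O σ α X t).count i : ℝ) ≤ B then (1 : ℝ) else 0) ≤ B + 1 := by
  -- The bound by the current count is carried along for the induction: at a scarce sample the sum
  -- so far is at most the count, hence at most `B`, and so can grow by one.
  suffices h : (∑ t ∈ Finset.range T, if i ∈ pulls O σ α (t + 1) (run O σ α X t) ∧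
      ((run O σ α X t).count i : ℝ) ≤ B then (1 : ℝ) else 0) ≤
      min ((run O σ α X T).count i : ℝ) (B + 1) from h.trans (min_le_right _ _)
  induction T with
  | zero => simp [run]; linarith
  | succ T ih =>
    rw [Finset.sum_range_succ, run_count_succ]
    obtain ⟨h1, h2⟩ := le_min_iff.1 ih
    by_cases hp : i ∈ pulls O σ α (T + 1) (run O σ α X T)
    · by_cases hc : ((run O σ α X T).count i : ℝ) ≤ B
      · simp only [hp, hc, and_self, if_true, Nat.cast_add, Nat.cast_one]
        exact le_min (by linarith) (by linarith)
      · simp only [hp, hc, and_false, if_true, if_false, Nat.cast_add, Nat.cast_one]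
        exact le_min (by linarith) (by linarith)
    · simp only [hp, false_and, if_false, add_zero]
      exact ih

/-- With correct confidence bounds, a period in which an existing stable assignment is not
certified samples a good that has been sampled rarely. -/
lemma exists_scarce_pulled {M : StableModel K N} {c α η ε : ℝ} {σ : ℝ} {μ : Fin N → ℝ}
    {O : (Fin N → ℝ) → (Fin N → ℝ) → OracleOutput K N} (hα : 0 ≤ α)
    (hc : 0 < c) (hM : M.LipschitzMonotone c) (hε : ε < η) (hO : IsOracle M η ε O)
    (hμ : (M.stableSet μ η).Nonempty) {t T : ℕ} (ht : N < t) (htT : t ≤ T) {s : Stats N}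
    (hlo : s.lcb σ α t ≤ μ) (hup : μ ≤ s.ucb σ α t)
    (hr : ¬ M.Rejects ε (s.lcb σ α t) (s.ucb σ α t)) :
    ∃ i ∈ pulls O σ α t s,
      (s.count i : ℝ) ≤ 32 * c ^ 2 * σ ^ 2 * α * N ^ 2 * Real.log T / (η - ε) ^ 2 := by
  obtain ⟨φ, hφ, hres⟩ := hμ
  -- Optimism: `hres.mono` shows that the truly stable assignment passes the optimistic test, so the
  -- oracle must return one that passes.
  have hopt := hO.optimistic _ _ hr ⟨φ, hφ, hres.mono hM hφ hup hlo⟩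
  obtain ⟨hd, hlt⟩ := hO.evidence _ _ hr
  obtain ⟨i, hi, hwide⟩ := StableModel.exists_wide_good hc hM (hO.feasible _ _) hd
    (m := s.mean) (w := s.radius σ α t) (fun i => Real.sqrt_nonneg _) hε (hopt _ _ hd) hlt
  refine ⟨i, ?_, ?_⟩
  · simpa [pulls, not_le.2 ht] using hi
  have ht1 : (1 : ℝ) ≤ t := by exact_mod_cast (by omega : 1 ≤ t)
  have hlog : Real.log t ≤ Real.log T := Real.log_le_log (by linarith) (by exact_mod_cast htT)
  have hlog0 : 0 ≤ Real.log t := Real.log_nonneg ht1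
  rw [le_div_iff₀ (by have := sub_pos.2 hε; positivity)]
  have hsq : (η - ε) ^ 2 ≤ (4 * c * N * s.radius σ α t i) ^ 2 :=
    pow_le_pow_left₀ (by linarith) hwide 2
  rw [mul_pow, Stats.radius, Real.log_rpow (by linarith), Real.sq_sqrt (by positivity)] at hsq
  calc (s.count i : ℝ) * (η - ε) ^ 2
      ≤ s.count i * ((4 * c * N) ^ 2 * (1 / s.count i * (2 * σ ^ 2 * (α * Real.log t)))) := by
        gcongr
    -- The product of the count and its inverse is at most one even for count zero, where the
    -- inverse is zero by convention.
    _ = (s.count i * (s.count i : ℝ)⁻¹) * (32 * c ^ 2 * σ ^ 2 * α * N ^ 2 * Real.log t) := by ring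
    _ ≤ 1 * (32 * c ^ 2 * σ ^ 2 * α * N ^ 2 * Real.log T) := by
        gcongr
        exact mul_inv_le_one
    _ = _ := one_mul _

end Run

/-! ### Measurability of the run with respect to an arbitrary σ-algebra. -/

section Measurability

variable {Ω : Type*} {m : MeasurableSpace Ω}

lemma measurable_ucb_lcb {s : Ω → Stats N} (hc : ∀ i, Measurable fun ω => (s ω).count i)
    (ht : ∀ i, Measurable fun ω => (s ω).total i) (σ α : ℝ) (t : ℕ) :
    Measurable fun ω => ((s ω).lcb σ α t, (s ω).ucb σ α t) := by
  have hc' : ∀ i, Measurable fun ω => ((s ω).count i : ℝ) := fun i =>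
    measurable_from_nat.comp (hc i)
  unfold Stats.lcb Stats.ucb Stats.mean Stats.radius
  refine Measurable.prodMk (measurable_pi_lambda _ fun i => ?_) (measurable_pi_lambda _ fun i => ?_)
  · exact ((ht i).div (hc' i)).sub ((measurable_const.div (hc' i)).mul_const _).sqrt
  · exact ((ht i).div (hc' i)).add ((measurable_const.div (hc' i)).mul_const _).sqrt

lemma measurableSet_mem_pulls {O : (Fin N → ℝ) → (Fin N → ℝ) → OracleOutput K N}
    (hO : ∀ o, MeasurableSet {p : (Fin N → ℝ) × (Fin N → ℝ) | O p.1 p.2 = o})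
    {s : Ω → Stats N} (hc : ∀ i, Measurable fun ω => (s ω).count i)
    (ht : ∀ i, Measurable fun ω => (s ω).total i) (σ α : ℝ) (t : ℕ) (i : Fin N) :
    MeasurableSet {ω | i ∈ pulls O σ α t (s ω)} := by
  unfold pulls
  split_ifs
  · exact MeasurableSet.const _
  · have h : MeasurableSet (⋃ (o : OracleOutput K N)
        (_ : i ∈ o.L.biUnion (fun j => o.φ j ∪ o.φ' j)),
        {p : (Fin N → ℝ) × (Fin N → ℝ) | O p.1 p.2 = o}) :=
      MeasurableSet.iUnion fun o => MeasurableSet.iUnion fun _ => hO o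
    convert measurable_ucb_lcb hc ht σ α t h using 1
    ext ω
    simp

/-- Only signals up to period `t` are required to be measurable, so the σ-algebra can be that of the
noise up to `t`. This makes the samples of period `t + 1` predictable. -/
lemma measurable_run {O : (Fin N → ℝ) → (Fin N → ℝ) → OracleOutput K N}
    (hO : ∀ o, MeasurableSet {p : (Fin N → ℝ) × (Fin N → ℝ) | O p.1 p.2 = o})
    {X : ℕ → Fin N → Ω → ℝ} (σ α : ℝ) (t : ℕ) (hX : ∀ s ≤ t, ∀ i, Measurable (X s i)) :
    (∀ i, Measurable fun ω => (run O σ α (fun s i => X s i ω) t).count i) ∧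
      ∀ i, Measurable fun ω => (run O σ α (fun s i => X s i ω) t).total i := by
  induction t with
  | zero => exact ⟨fun i => measurable_const, fun i => measurable_const⟩
  | succ t ih =>
    obtain ⟨hc, ht⟩ := ih fun s hs => hX s (by omega)
    have hp := measurableSet_mem_pulls hO hc ht σ α (t + 1)
    exact ⟨fun i => (hc i).add (Measurable.ite (hp i) measurable_const measurable_const),
      fun i => (ht i).add (Measurable.ite (hp i) (hX _ le_rfl i) measurable_const)⟩

end Measurability

/-! ### Concentration under adaptive sampling. -/

section Concentration

variable {Ω : Type*} [MeasurableSpace Ω] {P : Measure Ω} {ξ : ℕ → Fin N → Ω → ℝ}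

lemma measurable_run_signals {O : (Fin N → ℝ) → (Fin N → ℝ) → OracleOutput K N}
    (hO : ∀ o, MeasurableSet {p : (Fin N → ℝ) × (Fin N → ℝ) | O p.1 p.2 = o})
    (hξ : ∀ t i, Measurable (ξ t i)) (μ : Fin N → ℝ) (σ α : ℝ) (t : ℕ) :
    (∀ i, Measurable fun ω => (run O σ α (fun t i => μ i + ξ t i ω) t).count i) ∧
      ∀ i, Measurable fun ω => (run O σ α (fun t i => μ i + ξ t i ω) t).total i :=
  measurable_run (X := fun t i ω => μ i + ξ t i ω) hO σ α t fun s _ i => (hξ s i).const_add _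

/-- The factor by which one sample multiplies the exponential supermartingale. -/
lemma lintegral_exp_centered_le_one [IsProbabilityMeasure P] {Y : Ω → ℝ} {v : ℝ≥0}
    (hY : HasSubgaussianMGF Y v P) (l : ℝ) :
    ∫⁻ ω, ENNReal.ofReal (Real.exp (l * Y ω - l ^ 2 * v / 2)) ∂P ≤ 1 := by
  have hint : Integrable (fun ω => Real.exp (l * Y ω - l ^ 2 * v / 2)) P := by
    simp only [Real.exp_sub]
    exact (hY.integrable_exp_mul l).div_const _
  rw [← ofReal_integral_eq_lintegral_ofReal hint (ae_of_all _ fun _ => (Real.exp_pos _).le),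
    ← ENNReal.ofReal_one]
  refine ENNReal.ofReal_le_ofReal ?_
  simp only [Real.exp_sub]
  rw [integral_div, div_le_one (Real.exp_pos _)]
  refine (hY.mgf_le l).trans_eq ?_
  ring_nf

/-- The exponential of the accumulated noise of a good, compensated by the number of its samples,
has expectation at most one although the samples are taken adaptively. -/
lemma lintegral_exp_noise_le_one [IsProbabilityMeasure P]
    {O : (Fin N → ℝ) → (Fin N → ℝ) → OracleOutput K N}
    (hO : ∀ o, MeasurableSet {p : (Fin N → ℝ) × (Fin N → ℝ) | O p.1 p.2 = o})
    (hξ : ∀ t i, Measurable (ξ t i))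
    (hind : iIndepFun (fun (t : ℕ) (ω : Ω) (i : Fin N) => ξ t i ω) P) {v : ℝ≥0}
    (hsub : ∀ t i, HasSubgaussianMGF (ξ t i) v P) (μ : Fin N → ℝ) (σ α l : ℝ) (i : Fin N) (t : ℕ) :
    ∫⁻ ω, ENNReal.ofReal (Real.exp
      (l * ((run O σ α (fun t i => μ i + ξ t i ω) t).total i -
        (run O σ α (fun t i => μ i + ξ t i ω) t).count i * μ i) -
        l ^ 2 * v * (run O σ α (fun t i => μ i + ξ t i ω) t).count i / 2)) ∂P ≤ 1 := by
  induction t with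
  | zero => simp [run]
  | succ t ih =>
    have hvec : ∀ t, Measurable fun (ω : Ω) (i : Fin N) => ξ t i ω := fun t =>
      measurable_pi_lambda _ fun i => hξ t i
    let F := Filtration.natural (fun (t : ℕ) (ω : Ω) (i : Fin N) => ξ t i ω)
      fun t => (hvec t).stronglyMeasurable
    have hF : ∀ s ≤ t, ∀ i, Measurable[F t] (ξ s i) := by
      intro s hs i
      have h1 : MeasurableSpace.comap (fun (ω : Ω) (i : Fin N) => ξ s i ω) inferInstance ≤ F t :=
        le_iSup₂_of_le (f := fun j (_ : j ≤ t) =>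
          MeasurableSpace.comap (fun (ω : Ω) (i : Fin N) => ξ j i ω) inferInstance) s hs le_rfl
      exact ((measurable_pi_apply i).comp (comap_measurable _)).mono h1 le_rfl
    obtain ⟨hc, htot⟩ := measurable_run (m := F t) (X := fun t i ω => μ i + ξ t i ω) hO σ α t
      fun s hs i => (hF s hs i).const_add _
    have hA := measurableSet_mem_pulls (m := F t) hO hc htot σ α (t + 1) i
    have hindep := (hind.indep_comap_natural_of_lt
      (fun t => (hvec t).stronglyMeasurable) (Nat.lt_succ_self t)).symm
    set A : Set Ω := {ω | i ∈ pulls O σ α (t + 1) (run O σ α (fun t i => μ i + ξ t i ω) t)}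
    set f : Ω → ENNReal := fun ω => ENNReal.ofReal (Real.exp
      (l * ((run O σ α (fun t i => μ i + ξ t i ω) t).total i -
        (run O σ α (fun t i => μ i + ξ t i ω) t).count i * μ i) -
        l ^ 2 * v * (run O σ α (fun t i => μ i + ξ t i ω) t).count i / 2)) with hf
    set g : Ω → ENNReal := fun ω =>
      ENNReal.ofReal (Real.exp (l * ξ (t + 1) i ω - l ^ 2 * v / 2)) with hg
    have hfm : Measurable[F t] f := by
      have hc' : Measurable[F t] fun ω =>
          ((run O σ α (fun t i => μ i + ξ t i ω) t).count i : ℝ) :=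
        measurable_from_nat.comp (hc i)
      exact ((((((htot i).sub (hc'.mul_const _)).const_mul l).sub
        ((hc'.const_mul _).div_const 2))).exp).ennreal_ofReal
    have hgm : Measurable[MeasurableSpace.comap
        (fun (ω : Ω) (i : Fin N) => ξ (t + 1) i ω) inferInstance] g := by
      have : Measurable fun x : Fin N → ℝ =>
          ENNReal.ofReal (Real.exp (l * x i - l ^ 2 * v / 2)) := by fun_prop
      exact this.comp (comap_measurable _)
    -- The process is unchanged off the sampling event `A` and is multiplied by `g` on it. Since `A`
    -- and `f` depend only on the past and `g` only on the fresh noise, the expectation of the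
    -- product factors.
    have hstep : ∀ ω, ENNReal.ofReal (Real.exp
        (l * ((run O σ α (fun t i => μ i + ξ t i ω) (t + 1)).total i -
          (run O σ α (fun t i => μ i + ξ t i ω) (t + 1)).count i * μ i) -
          l ^ 2 * v * (run O σ α (fun t i => μ i + ξ t i ω) (t + 1)).count i / 2)) =
        Aᶜ.indicator f ω + A.indicator f ω * g ω := by
      intro ω
      rw [run_total_succ, run_count_succ]
      by_cases hω : i ∈ pulls O σ α (t + 1) (run O σ α (fun t i => μ i + ξ t i ω) t)
      · have h1 : ω ∈ A := hω
        have h2 : ω ∉ Aᶜ := fun h => h h1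
        rw [Set.indicator_of_mem h1, Set.indicator_of_notMem h2, if_pos hω, if_pos hω, zero_add,
          hf, hg]
        simp only
        rw [← ENNReal.ofReal_mul (Real.exp_pos _).le, ← Real.exp_add]
        congr 2
        push_cast
        ring
      · have h1 : ω ∉ A := hω
        have h2 : ω ∈ Aᶜ := h1
        rw [Set.indicator_of_notMem h1, Set.indicator_of_mem h2, if_neg hω, if_neg hω, zero_mul,
          add_zero]
        simp [hf]
    have hA' : MeasurableSet A := F.le t _ hA
    have hf' : Measurable f := hfm.mono (F.le t) le_rfl
    rw [lintegral_congr hstep, lintegral_add_left (hf'.indicator hA'.compl),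
      lintegral_mul_eq_lintegral_mul_lintegral_of_independent_measurableSpace (F.le t)
        (hvec (t + 1)).comap_le hindep (hfm.indicator hA) hgm]
    calc _ ≤ ∫⁻ ω, Aᶜ.indicator f ω ∂P + (∫⁻ ω, A.indicator f ω ∂P) * 1 := by
          gcongr
          exact lintegral_exp_centered_le_one (hsub (t + 1) i) l
      _ = ∫⁻ ω, f ω ∂P := by
          rw [mul_one, lintegral_indicator hA'.compl, lintegral_indicator hA', add_comm,
            lintegral_add_compl f hA']
      _ ≤ 1 := ih

/-- Markov's inequality for the exponential supermartingale. The parameter `l` is deterministic, so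
it cannot yet be tuned to the random sample count. -/
lemma measure_exp_noise_le [IsProbabilityMeasure P]
    {O : (Fin N → ℝ) → (Fin N → ℝ) → OracleOutput K N}
    (hO : ∀ o, MeasurableSet {p : (Fin N → ℝ) × (Fin N → ℝ) | O p.1 p.2 = o})
    (hξ : ∀ t i, Measurable (ξ t i))
    (hind : iIndepFun (fun (t : ℕ) (ω : Ω) (i : Fin N) => ξ t i ω) P) {v : ℝ≥0}
    (hsub : ∀ t i, HasSubgaussianMGF (ξ t i) v P) (μ : Fin N → ℝ) (σ α l b : ℝ) (i : Fin N)
    (t : ℕ) :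
    P.real {ω | b ≤ l * ((run O σ α (fun t i => μ i + ξ t i ω) t).total i -
        (run O σ α (fun t i => μ i + ξ t i ω) t).count i * μ i) -
        l ^ 2 * v * (run O σ α (fun t i => μ i + ξ t i ω) t).count i / 2} ≤ Real.exp (-b) := by
  obtain ⟨hc, htot⟩ := measurable_run_signals hO hξ μ σ α t
  have hc' : Measurable fun ω => ((run O σ α (fun t i => μ i + ξ t i ω) t).count i : ℝ) :=
    measurable_from_nat.comp (hc i)
  have hm := ((((((htot i).sub (hc'.mul_const (μ i))).const_mul l).sub
    ((hc'.const_mul (l ^ 2 * v)).div_const 2))).exp).ennreal_ofReal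
  refine ENNReal.toReal_le_of_le_ofReal (Real.exp_pos _).le ?_
  have h := (meas_ge_le_lintegral_div (μ := P) hm.aemeasurable
    (ε := ENNReal.ofReal (Real.exp b)) (by simp [Real.exp_pos]) ENNReal.ofReal_ne_top).trans
    (ENNReal.div_le_div_right (lintegral_exp_noise_le_one hO hξ hind hsub μ σ α l i t) _)
  rw [Real.exp_neg, ENNReal.ofReal_inv_of_pos (Real.exp_pos _), ← one_div]
  refine (measure_mono fun ω hω => ?_).trans h
  exact ENNReal.ofReal_le_ofReal (Real.exp_le_exp.2 hω)

/-- A sampled good violates its confidence bounds with polynomially small probability. -/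
lemma measureReal_not_confident_le [IsProbabilityMeasure P]
    {O : (Fin N → ℝ) → (Fin N → ℝ) → OracleOutput K N}
    (hO : ∀ o, MeasurableSet {p : (Fin N → ℝ) × (Fin N → ℝ) | O p.1 p.2 = o})
    (hξ : ∀ t i, Measurable (ξ t i))
    (hind : iIndepFun (fun (t : ℕ) (ω : Ω) (i : Fin N) => ξ t i ω) P) {σ : ℝ≥0}
    (hsub : ∀ t i, HasSubgaussianMGF (ξ t i) (σ ^ 2) P) (hσ : 0 < σ) (μ : Fin N → ℝ) {α : ℝ}
    (hα : 0 ≤ α) {t : ℕ} (ht : N ≤ t) :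
    P.real {ω | ¬ ((run O σ α (fun t i => μ i + ξ t i ω) t).lcb σ α (t + 1) ≤ μ ∧
      μ ≤ (run O σ α (fun t i => μ i + ξ t i ω) t).ucb σ α (t + 1))} ≤
      2 * N * ((t + 1 : ℕ) : ℝ) ^ (1 - α) := by
  have hσ' : (0 : ℝ) < σ := hσ
  have ht1 : (0 : ℝ) < ((t + 1 : ℕ) : ℝ) := by positivity
  have hlog : 0 ≤ Real.log ((t + 1 : ℕ) : ℝ) := Real.log_nonneg (by push_cast; simp)
  let r : ℕ → ℝ := fun n => √(1 / (n : ℝ) * (2 * (σ : ℝ) ^ 2 * Real.log (((t + 1 : ℕ) : ℝ) ^ α)))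
  let b : ℝ := α * Real.log ((t + 1 : ℕ) : ℝ)
  have hr : ∀ n : ℕ, 0 < n → (n : ℝ) * r n ^ 2 = 2 * (σ : ℝ) ^ 2 * b := by
    intro n hn
    have hn' : (0 : ℝ) < n := by exact_mod_cast hn
    simp only [r, b]
    rw [Real.log_rpow ht1, Real.sq_sqrt (by positivity)]
    field_simp
  let E : Fin N → ℝ → Set Ω := fun i l =>
    {ω | b ≤ l * ((run O σ α (fun t i => μ i + ξ t i ω) t).total i -
        (run O σ α (fun t i => μ i + ξ t i ω) t).count i * μ i) -
        l ^ 2 * (σ ^ 2 : ℝ≥0) * (run O σ α (fun t i => μ i + ξ t i ω) t).count i / 2}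
  have hE : ∀ i l, P.real (E i l) ≤ Real.exp (-b) := fun i l =>
    measure_exp_noise_le hO hξ hind hsub μ σ α l b i t
  -- The optimal parameter `± r n / σ²` depends on the count `n`, which is random; hence the union
  -- over all possible values `1, …, t`.
  have hsubset : {ω | ¬ ((run O σ α (fun t i => μ i + ξ t i ω) t).lcb σ α (t + 1) ≤ μ ∧
      μ ≤ (run O σ α (fun t i => μ i + ξ t i ω) t).ucb σ α (t + 1))} ⊆
      ⋃ i ∈ (Finset.univ : Finset (Fin N)), ⋃ n ∈ Finset.Icc 1 t,
        (E i (r n / σ ^ 2) ∪ E i (-(r n / σ ^ 2))) := by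
    intro ω hω
    simp only [Set.mem_iUnion, Finset.mem_univ, exists_true_left, Finset.mem_Icc]
    have hω' : ¬ ((run O σ α (fun t i => μ i + ξ t i ω) t).lcb σ α (t + 1) ≤ μ ∧
      μ ≤ (run O σ α (fun t i => μ i + ξ t i ω) t).ucb σ α (t + 1)) := hω
    rw [not_and_or, Pi.le_def, Pi.le_def, not_forall, not_forall] at hω'
    -- At the tuned parameter the compensator equals `b`, so a linear term of at least `2b` leaves
    -- an exponent of at least `b`. Fixing only `l ^ 2` covers both tails.
    have main : ∀ i : Fin N, ∀ l : ℝ,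
        l ^ 2 = (r ((run O σ α (fun t i => μ i + ξ t i ω) t).count i) / σ ^ 2) ^ 2 →
        2 * b ≤ l * ((run O σ α (fun t i => μ i + ξ t i ω) t).total i -
          (run O σ α (fun t i => μ i + ξ t i ω) t).count i * μ i) → ω ∈ E i l := by
      intro i l hl hle
      have h1 := hr _ (run_count_pos O σ α (fun t i => μ i + ξ t i ω) ht i)
      have h2 : l ^ 2 * ((σ ^ 2 : ℝ≥0) : ℝ) *
          (run O σ α (fun t i => μ i + ξ t i ω) t).count i / 2 = b := by
        rw [hl]
        push_cast
        field_simp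
        rw [mul_comm, h1]
        ring
      change b ≤ _
      rw [h2]
      linarith
    have hmean : ∀ i : Fin N, ((run O σ α (fun t i => μ i + ξ t i ω) t).count i : ℝ) *
        (run O σ α (fun t i => μ i + ξ t i ω) t).mean i =
        (run O σ α (fun t i => μ i + ξ t i ω) t).total i := by
      intro i
      have h1 : (0 : ℝ) < (run O σ α (fun t i => μ i + ξ t i ω) t).count i := by
        exact_mod_cast run_count_pos O σ α (fun t i => μ i + ξ t i ω) ht i
      rw [Stats.mean]
      field_simp
    have key : ∀ i : Fin N, ∀ d : ℝ,
        r ((run O σ α (fun t i => μ i + ξ t i ω) t).count i) ≤ d →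
        2 * b ≤ r ((run O σ α (fun t i => μ i + ξ t i ω) t).count i) / σ ^ 2 *
          ((run O σ α (fun t i => μ i + ξ t i ω) t).count i * d) := by
      intro i d hd
      have h1 := hr _ (run_count_pos O σ α (fun t i => μ i + ξ t i ω) ht i)
      calc 2 * b = r ((run O σ α (fun t i => μ i + ξ t i ω) t).count i) / σ ^ 2 *
          ((run O σ α (fun t i => μ i + ξ t i ω) t).count i *
            r ((run O σ α (fun t i => μ i + ξ t i ω) t).count i)) := by
            field_simp
            linarith
        _ ≤ _ := by
            have : 0 ≤ r ((run O σ α (fun t i => μ i + ξ t i ω) t).count i) := Real.sqrt_nonneg _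
            gcongr
    rcases hω' with ⟨i, hi⟩ | ⟨i, hi⟩
    · refine ⟨i, _, ⟨run_count_pos O σ α (fun t i => μ i + ξ t i ω) ht i,
        run_count_le O σ α (fun t i => μ i + ξ t i ω) t i⟩, Or.inl (main i _ rfl ?_)⟩
      have h2 : μ i < (run O σ α (fun t i => μ i + ξ t i ω) t).mean i -
        r ((run O σ α (fun t i => μ i + ξ t i ω) t).count i) := not_le.1 hi
      rw [← hmean, ← mul_sub]
      exact key i _ (by linarith)
    · refine ⟨i, _, ⟨run_count_pos O σ α (fun t i => μ i + ξ t i ω) ht i,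
        run_count_le O σ α (fun t i => μ i + ξ t i ω) t i⟩, Or.inr (main i _ (neg_sq _) ?_)⟩
      have h2 : (run O σ α (fun t i => μ i + ξ t i ω) t).mean i +
        r ((run O σ α (fun t i => μ i + ξ t i ω) t).count i) < μ i := not_le.1 hi
      rw [← hmean, ← mul_sub, neg_mul, ← mul_neg, ← mul_neg, neg_sub]
      exact key i _ (by linarith)
  calc _ ≤ P.real (⋃ i ∈ (Finset.univ : Finset (Fin N)), ⋃ n ∈ Finset.Icc 1 t,
        (E i (r n / σ ^ 2) ∪ E i (-(r n / σ ^ 2)))) := measureReal_mono hsubset (measure_ne_top _ _)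
    _ ≤ ∑ _i : Fin N, ∑ _n ∈ Finset.Icc 1 t, (Real.exp (-b) + Real.exp (-b)) := by
        refine (measureReal_biUnion_finset_le _ _).trans (Finset.sum_le_sum fun i _ => ?_)
        refine (measureReal_biUnion_finset_le _ _).trans (Finset.sum_le_sum fun n _ => ?_)
        exact (measureReal_union_le _ _).trans (add_le_add (hE _ _) (hE _ _))
    _ = 2 * N * (t * Real.exp (-b)) := by
        simp only [Finset.sum_const, Nat.card_Icc, Finset.card_univ, Fintype.card_fin, nsmul_eq_mul]
        simp only [add_tsub_cancel_right]
        ring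
    -- The union over counts costs a factor `t`; this turns the exponent `-α` into `1 - α`.
    _ ≤ 2 * N * (((t + 1 : ℕ) : ℝ) * Real.exp (-b)) := by
        gcongr
        simp
    _ = 2 * N * ((t + 1 : ℕ) : ℝ) ^ (1 - α) := by
        rw [sub_eq_add_neg, Real.rpow_add ht1, Real.rpow_one, Real.rpow_def_of_pos ht1 (-α)]
        simp only [b]
        ring_nf

end Concentration

/-! ### Counting acceptances and taking expectations. -/

section AcceptCount

variable {M : StableModel K N} {c α η ε : ℝ} {O : (Fin N → ℝ) → (Fin N → ℝ) → OracleOutput K N}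

lemma acceptCount_eq_sum_range (σ : ℝ) (X : ℕ → Fin N → ℝ) (T : ℕ) :
    acceptCount M O σ α ε X T =
      ∑ t ∈ Finset.range T, if decision M O σ α ε X (t + 1) = 0 then 1 else 0 := by
  rw [acceptCount, Finset.range_eq_Ico, Finset.sum_Ico_add'
    (fun t => if decision M O σ α ε X t = 0 then (1 : ℝ) else 0) 0 T 1]
  rfl

open Classical in
/-- The acceptances are the initial periods, the periods with wrong confidence bounds, and a
logarithmic number of periods for every good. -/
lemma acceptCount_le {σ : ℝ} {μ : Fin N → ℝ} (hα : 0 ≤ α) (hc : 0 < c)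
    (hM : M.LipschitzMonotone c) (hε : ε < η) (hO : IsOracle M η ε O)
    (hμ : (M.stableSet μ η).Nonempty) (X : ℕ → Fin N → ℝ) {T : ℕ} (hT : 0 < T) :
    acceptCount M O σ α ε X T ≤
      N * (32 * c ^ 2 * σ ^ 2 * α * N ^ 2 * Real.log T / (η - ε) ^ 2 + 2) +
      ∑ t ∈ Finset.range T, if N ≤ t ∧ ¬ ((run O σ α X t).lcb σ α (t + 1) ≤ μ ∧
        μ ≤ (run O σ α X t).ucb σ α (t + 1)) then 1 else 0 := by
  set B := 32 * c ^ 2 * σ ^ 2 * α * N ^ 2 * Real.log T / (η - ε) ^ 2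
  have hB : 0 ≤ B := by
    have : 0 ≤ Real.log T := Real.log_nonneg (by exact_mod_cast hT)
    have := sub_pos.2 hε
    positivity
  have hinit : (∑ t ∈ Finset.range T, if t < N then (1 : ℝ) else 0) ≤ N := by
    rw [← Finset.sum_filter, Finset.sum_const, nsmul_eq_mul, mul_one]
    have : (Finset.range T).filter (· < N) ⊆ Finset.range N := fun t ht => by
      simpa using (Finset.mem_filter.1 ht).2
    exact_mod_cast (Finset.card_le_card this).trans_eq (Finset.card_range N)
  have hscarce : (∑ t ∈ Finset.range T, ∑ i : Fin N,
      if i ∈ pulls O σ α (t + 1) (run O σ α X t) ∧ ((run O σ α X t).count i : ℝ) ≤ B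
        then (1 : ℝ) else 0) ≤ N * (B + 1) := by
    rw [Finset.sum_comm]
    refine (Finset.sum_le_sum fun i _ => sum_pulled_scarce_le O σ α X hB i T).trans_eq ?_
    simp [mul_add]
  -- Each acceptance is charged to at least one of the three terms. The index `t` refers to the
  -- statistics before period `t + 1`. The summand `2` in the final bound combines the `N` initial
  -- periods with the `+ 1` of every good.
  have hterm : acceptCount M O σ α ε X T ≤ ∑ t ∈ Finset.range T,
      ((if t < N then (1 : ℝ) else 0) + (∑ i : Fin N,
        if i ∈ pulls O σ α (t + 1) (run O σ α X t) ∧ ((run O σ α X t).count i : ℝ) ≤ B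
          then (1 : ℝ) else 0) +
        if N ≤ t ∧ ¬ ((run O σ α X t).lcb σ α (t + 1) ≤ μ ∧
          μ ≤ (run O σ α X t).ucb σ α (t + 1)) then 1 else 0) := by
    rw [acceptCount_eq_sum_range]
    refine Finset.sum_le_sum fun t ht => ?_
    have h0 : ∀ i : Fin N, (0 : ℝ) ≤ if i ∈ pulls O σ α (t + 1) (run O σ α X t) ∧
        ((run O σ α X t).count i : ℝ) ≤ B then (1 : ℝ) else 0 := fun i => by
      split_ifs <;> norm_num
    have h1 := Finset.sum_nonneg fun i (_ : i ∈ Finset.univ) => h0 i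
    by_cases hd : decision M O σ α ε X (t + 1) = 0
    swap
    · rw [if_neg hd]
      exact add_nonneg (add_nonneg (by split_ifs <;> norm_num) h1) (by split_ifs <;> norm_num)
    rw [if_pos hd]
    rcases lt_or_ge t N with hN | hN
    · rw [if_pos hN, if_neg (fun h => absurd h.1 (not_le.2 hN))]
      linarith
    rw [if_neg (not_lt.2 hN)]
    by_cases hg : (run O σ α X t).lcb σ α (t + 1) ≤ μ ∧ μ ≤ (run O σ α X t).ucb σ α (t + 1)
    swap
    · rw [if_pos ⟨hN, hg⟩]
      linarith
    have hr : ¬ M.Rejects ε ((run O σ α X t).lcb σ α (t + 1))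
        ((run O σ α X t).ucb σ α (t + 1)) := by
      intro hr
      have h2 : N < t + 1 ∧ M.Rejects ε ((run O σ α X (t + 1 - 1)).lcb σ α (t + 1))
        ((run O σ α X (t + 1 - 1)).ucb σ α (t + 1)) := ⟨by omega, hr⟩
      simp only [decision, if_pos h2] at hd
      exact one_ne_zero hd
    obtain ⟨i, hi, hcount⟩ := exists_scarce_pulled hα hc hM hε hO hμ (by omega : N < t + 1)
      (Finset.mem_range.1 ht : t + 1 ≤ T) hg.1 hg.2 hr
    have h3 := Finset.single_le_sum (fun i _ => h0 i) (Finset.mem_univ i)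
    rw [if_pos ⟨hi, hcount⟩] at h3
    rw [if_neg (fun h => h.2 hg)]
    linarith
  rw [Finset.sum_add_distrib, Finset.sum_add_distrib] at hterm
  linarith

variable {Ω : Type*} [MeasurableSpace Ω] {P : Measure Ω} {ξ : ℕ → Fin N → Ω → ℝ}

lemma integrable_acceptCount [IsProbabilityMeasure P] (hM : M.LipschitzMonotone c)
    (hO : ∀ o, MeasurableSet {p : (Fin N → ℝ) × (Fin N → ℝ) | O p.1 p.2 = o})
    (hξ : ∀ t i, Measurable (ξ t i)) (μ : Fin N → ℝ) (σ : ℝ) (T : ℕ) :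
    Integrable (fun ω => acceptCount M O σ α ε (fun t i => μ i + ξ t i ω) T) P := by
  refine integrable_finsetSum _ fun t _ => ?_
  have hdec : MeasurableSet
      {ω | decision M O σ α ε (fun t i => μ i + ξ t i ω) t = 0} := by
    obtain ⟨hc, htot⟩ := measurable_run_signals hO hξ μ σ α (t - 1)
    have h := measurable_ucb_lcb hc htot σ α t (StableModel.measurableSet_rejects hM ε)
    have h2 := ((MeasurableSet.const (N < t)).inter h).compl
    convert h2 using 1
    ext ω
    simp only [decision, Set.mem_ofPred_eq, Set.mem_compl_iff, Set.mem_inter_iff, Set.mem_preimage]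
    split_ifs with h3 <;> simp [h3]
  refine Integrable.of_bound (C := 1)
    (Measurable.ite hdec measurable_const measurable_const).aestronglyMeasurable
    (ae_of_all _ fun ω => ?_)
  split_ifs <;> simp

lemma integral_acceptCount_le [IsProbabilityMeasure P] {σ : ℝ≥0} {μ : Fin N → ℝ}
    (hξ : ∀ t i, Measurable (ξ t i))
    (hind : iIndepFun (fun (t : ℕ) (ω : Ω) (i : Fin N) => ξ t i ω) P)
    (hsub : ∀ t i, HasSubgaussianMGF (ξ t i) (σ ^ 2) P) (hσ : 0 < σ) (hα : 2 < α) (hc : 0 < c)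
    (hM : M.LipschitzMonotone c) (hε : ε < η) (hO : IsOracle M η ε O)
    (hμ : (M.stableSet μ η).Nonempty) {T : ℕ} (hT : 0 < T) :
    ∫ ω, acceptCount M O σ α ε (fun t i => μ i + ξ t i ω) T ∂P ≤
      N * (32 * c ^ 2 * (σ : ℝ) ^ 2 * α * N ^ 2 * Real.log T / (η - ε) ^ 2 + 2) +
      2 * N * ∑' t : ℕ, (t : ℝ) ^ (1 - α) := by
  classical
  let W : ℕ → Set Ω := fun t => {ω | N ≤ t ∧
    ¬ ((run O σ α (fun t i => μ i + ξ t i ω) t).lcb σ α (t + 1) ≤ μ ∧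
      μ ≤ (run O σ α (fun t i => μ i + ξ t i ω) t).ucb σ α (t + 1))}
  have hW : ∀ t, MeasurableSet (W t) := by
    intro t
    obtain ⟨hcm, htm⟩ := measurable_run_signals hO.measurable hξ μ σ α t
    have h := measurable_ucb_lcb hcm htm (σ : ℝ) α (t + 1)
    exact (MeasurableSet.const _).inter ((measurableSet_le h.fst measurable_const).inter
      (measurableSet_le measurable_const h.snd)).compl
  have hint : ∀ t, Integrable ((W t).indicator fun _ => (1 : ℝ)) P := fun t =>
    (integrable_const _).indicator (hW t)
  have hWle : ∀ t, P.real (W t) ≤ 2 * N * ((t + 1 : ℕ) : ℝ) ^ (1 - α) := by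
    intro t
    by_cases ht : N ≤ t
    · refine (measureReal_mono fun ω hω => ?_).trans
        (measureReal_not_confident_le hO.measurable hξ hind hsub hσ μ (by linarith) ht)
      exact hω.2
    · have : W t = ∅ := Set.eq_empty_of_forall_notMem fun ω hω => ht hω.1
      rw [this, measureReal_empty]
      positivity
  have hsum : Summable fun t : ℕ => (t : ℝ) ^ (1 - α) :=
    Real.summable_nat_rpow.2 (by linarith)
  set B := (N : ℝ) * (32 * c ^ 2 * (σ : ℝ) ^ 2 * α * N ^ 2 * Real.log T / (η - ε) ^ 2 + 2)
  calc ∫ ω, acceptCount M O σ α ε (fun t i => μ i + ξ t i ω) T ∂P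
      ≤ ∫ ω, (B + ∑ t ∈ Finset.range T, (W t).indicator (fun _ => (1 : ℝ)) ω) ∂P := by
        refine integral_mono (integrable_acceptCount hM hO.measurable hξ μ σ T)
          ((integrable_const _).add (integrable_finsetSum _ fun t _ => hint t)) fun ω => ?_
        refine (acceptCount_le (σ := σ) (by linarith) hc hM hε hO hμ _ hT).trans_eq ?_
        simp only [W, Set.indicator_apply, Set.mem_ofPred_eq, B]
    _ = B + ∑ t ∈ Finset.range T, P.real (W t) := by
        rw [integral_add (integrable_const _) (integrable_finsetSum _ fun t _ => hint t),
          integral_finsetSum _ fun t _ => hint t]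
        simp [integral_indicator_const, hW]
    _ ≤ B + ∑ t ∈ Finset.range T, 2 * N * ((t + 1 : ℕ) : ℝ) ^ (1 - α) := by
        gcongr with t _
        exact hWle t
    _ ≤ B + 2 * N * ∑' t : ℕ, (t : ℝ) ^ (1 - α) := by
        rw [← Finset.mul_sum]
        gcongr
        have h := ((summable_nat_add_iff 1).2 hsum).sum_le_tsum (Finset.range T)
          fun t _ => by positivity
        refine h.trans ?_
        -- The shifted series omits only the term at zero, which is nonnegative.
        rw [hsum.tsum_eq_zero_add]
        have : (0 : ℝ) ≤ ((0 : ℕ) : ℝ) ^ (1 - α) := by positivity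
        linarith

end AcceptCount

end FeasibilityULCB

/-! ### Choice of the constants. -/

theorem theorem6 :
    ∃ (C₁ : ℕ → ℝ → ℝ → ℝ → ℝ) (C₂ : ℝ → ℝ),
      ∀ (K N : ℕ) (M : FeasibilityULCB.StableModel K N)
        (c α η ε Δ : ℝ) (σ : ℝ≥0) (μ : Fin N → ℝ)
        (O : (Fin N → ℝ) → (Fin N → ℝ) → FeasibilityULCB.OracleOutput K N) (T : ℕ)
        (Ω : Type u) [MeasurableSpace Ω] (P : Measure Ω) [IsProbabilityMeasure P]
        (ξ : ℕ → Fin N → Ω → ℝ),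
        -- the noise: independent across periods and subgaussian
        (∀ t i, Measurable (ξ t i)) →
        iIndepFun (fun (t : ℕ) (ω : Ω) (i : Fin N) => ξ t i ω) P →
        (∀ t i, HasSubgaussianMGF (ξ t i) (σ ^ 2) P) →
        0 < σ → 2 < α → N < T →
        -- the assumptions on the rewards and on the separation
        0 < c → M.LipschitzMonotone c →
        0 < η → 0 < Δ → M.Separated μ η Δ → η - Δ < ε → ε < η →
        -- the oracle of the algorithm
        FeasibilityULCB.IsOracle M η ε O →
        -- the alternative hypothesis
        (M.stableSet μ η).Nonempty →
        Integrable (fun ω => FeasibilityULCB.acceptCount M O σ α ε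
          (fun t i => μ i + ξ t i ω) T) P ∧
        ∫ ω, FeasibilityULCB.acceptCount M O σ α ε (fun t i => μ i + ξ t i ω) T ∂P ≤
          C₁ M.κ ((σ : ℝ) ^ 2) c α * (Δ ^ (-2 : ℤ) + 2 * (η - ε) ^ (-2 : ℤ)) * (N : ℝ) ^ 3
            * Real.log T + N * C₂ α := by
  -- The coalition size does not enter `C₁`, because each acceptance is charged to a single good. In
  -- `C₂` the factor in front of the series comes from the two tails.
  refine ⟨fun _ v c α => 32 * c ^ 2 * v * α, fun α => 2 + 2 * ∑' t : ℕ, (t : ℝ) ^ (1 - α), ?_⟩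
  intro K N M c α η ε Δ σ μ O T Ω _ P _ ξ hξ hind hsub hσ hα hT hc hM _ _ _ _ hε hO hμ
  refine ⟨FeasibilityULCB.integrable_acceptCount hM hO.measurable hξ μ σ T, ?_⟩
  refine (FeasibilityULCB.integral_acceptCount_le hξ hind hsub hσ hα hc hM hε hO hμ
    (by omega)).trans ?_
  have hlog : 0 ≤ Real.log T := Real.log_nonneg (by exact_mod_cast (by omega : 1 ≤ T))
  have hD : (0 : ℝ) ≤ Δ ^ (-2 : ℤ) := by positivity
  have hG : 0 ≤ (η - ε) ^ (-2 : ℤ) := by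
    have := sub_pos.2 hε
    positivity
  -- The argument produces a single `(η - ε)⁻²`; the other terms of the stated rate are nonnegative
  -- slack.
  have hrate : (32 * c ^ 2 * (σ : ℝ) ^ 2 * α) * (η - ε) ^ (-2 : ℤ) * (N : ℝ) ^ 3 * Real.log T ≤
      (32 * c ^ 2 * (σ : ℝ) ^ 2 * α) * (Δ ^ (-2 : ℤ) + 2 * (η - ε) ^ (-2 : ℤ)) * (N : ℝ) ^ 3 *
        Real.log T := by
    gcongr
    linarith
  rw [show (η - ε) ^ (-2 : ℤ) = ((η - ε) ^ 2)⁻¹ by rw [zpow_neg]; norm_cast] at hrate ⊢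
  rw [div_eq_mul_inv]
  linarith
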